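/- Let $n \geq 1$ be an integer and let $s \geq 0$ be real. Let $\mathcal{C} \subset \mathbb{R}^n$ be an $n$-point configuration on $\mathbb{R}$, i.e. a set of $n$-tuples $(x_1,\dots,x_n)$ of pairwise distinct real numbers, and suppose that $\mathcal{C} = \bigcup_{i=1}^\infty Z_i$ is a countable union of bounded sets $Z_i$, each of lower Minkowski dimension at most $s$. Then there exists a set $X \subset [0,1]$ that avoids $\mathcal{C}$ (no $n$-tuple of pairwise distinct points of $X$ belongs to $\mathcal{C}$) and whose Fourier dimension satisfies \[ \dim_{\mathbb F}(X) \geq \frac{n-s}{n}. \] Here the lower Minkowski dimension of a bounded set $E \subset \mathbb{R}^n$ is $\liminf_{l \to 0^+} \log N(l,E)/\log(1/l)$, where $N(l,E)$ is the least number of axis-parallel cubes of sidelength $l$ needed to cover $E$ (the empty set is given dimension $0$). For a finite Borel measure $\mu$ on $\mathbb{R}$ let $\widehat{\mu}(\xi) = \int e^{-2\pi i \xi x}\, d\mu(x)$ and \[ \dim_{\mathbb F}(\mu) = \sup\Big\{ t \in (0,1] : \sup_{\xi \in \mathbb{R}} |\xi|^{t/2}\, |\widehat{\mu}(\xi)|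 < \infty \Big\}; \] $\dim_{\mathbb F}(X)$ is the supremum of $\dim_{\mathbb F}(\mu)$ over all nonzero finite Borel measures $\mu$ carried by a closed subset of $X$. The supremum of the empty set is $0$. -/

import Mathlib

open Filter Topology MeasureTheory

/-- The `n`-point configurations with entries in `A`: `n`-tuples of pairwise distinct points of `A`. -/
def configSpace (n : ℕ) (A : Set ℝ) : Set (Fin n → ℝ) :=
  {x | (∀ i, x i ∈ A) ∧ Function.Injective x}

/-- `X` avoids the `n`-point configuration `C`: no `n`-tuple of distinct points of `X` lies in `C`. -/
def AvoidsConfig {n : ℕ} (X : Set ℝ) (C : Set (Fin n → ℝ)) : Prop :=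
  Disjoint (configSpace n X) C

/-- The closed axis-parallel cube `∏ i, [a i, a i + l]` of sidelength `l`. -/
def sideCube {n : ℕ} (a : Fin n → ℝ) (l : ℝ) : Set (Fin n → ℝ) :=
  {x | ∀ i, a i ≤ x i ∧ x i ≤ a i + l}

/-- The minimum number of cubes of sidelength `l` required to cover the (bounded) set `E`. -/
noncomputable def cubeCoveringNumber {n : ℕ} (l : ℝ) (E : Set (Fin n → ℝ)) : ℕ :=
  sInf {m : ℕ | ∃ t : Finset (Fin n → ℝ), t.card = m ∧ E ⊆ ⋃ a ∈ t, sideCube a l}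

/-- The lower Minkowski dimension of a bounded set `E`: the lower limit of
`log N(l, E) / log (1 / l)` as `l` decreases to `0`. It is an extended real, so that the lower
limit needs no boundedness; the empty set gets dimension `0`. -/
noncomputable def lowerMinkowskiDim {n : ℕ} (E : Set (Fin n → ℝ)) : EReal :=
  liminf (fun l : ℝ => ((Real.log (cubeCoveringNumber l E) / Real.log (1 / l) : ℝ) : EReal))
    (𝓝[>] 0)

/-- The Fourier transform `ξ ↦ ∫ exp (-2πiξx) dμ(x)` of a finite Borel measure on `ℝ`. -/
noncomputable def measureFourier (μ : Measure ℝ) (ξ : ℝ) : ℂ :=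
  ∫ x : ℝ, Complex.exp (-2 * (Real.pi : ℂ) * Complex.I * (ξ : ℂ) * (x : ℂ)) ∂μ

/-- The Fourier dimension of a finite Borel measure on `ℝ`: the supremum of the `t ∈ (0, 1]` for
which `|ξ| ^ (t / 2) * |μ̂ ξ|` is bounded, and `0` if there is no such `t`. -/
noncomputable def fourierDimMeasure (μ : Measure ℝ) : ℝ :=
  sSup {t : ℝ | 0 < t ∧ t ≤ 1 ∧ ∃ M : ℝ, ∀ ξ : ℝ, |ξ| ^ (t / 2) * ‖measureFourier μ ξ‖ ≤ M}

/-- `μ` is supported on `E`: it is carried by a closed subset of `E`. -/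
def SupportedOn (μ : Measure ℝ) (E : Set ℝ) : Prop :=
  ∃ K : Set ℝ, IsClosed K ∧ K ⊆ E ∧ μ Kᶜ = 0

/-- The Fourier dimension of `E ⊆ ℝ`: the supremum of the Fourier dimensions of the nonzero finite
Borel measures supported on `E`, which all lie in `[0, 1]`, and `0` if `E` is empty. -/
noncomputable def fourierDim (E : Set ℝ) : ℝ :=
  sSup {t : ℝ | ∃ μ : Measure ℝ, IsFiniteMeasure μ ∧ μ ≠ 0 ∧ SupportedOn μ E ∧
    t = fourierDimMeasure μ}

/-!
The set `X` is the intersection of a decreasing sequence of finite unions of grid cells, which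
carry probability measures `μ k`, the average of the uniform measures on the cells, and the Fourier
dimension of `X` is bounded from below by means of a weak limit `ν` of the `μ k`.

The passage from `μ k` to `μ (k + 1)` is random. Fix a bounded piece `E` of `C`, a gap `δ` and an
exponent `t < (n - s) / n`. By the bound on the lower Minkowski dimension there are arbitrarily
small `l` for which about `l ^ (-s)` cubes of side `l` cover `E`. Cut the cells into pieces of
length `1 / H` with `H` about `1 / l`, and draw about `H ^ b` of these pieces independently and
uniformly, where `t < b < (n - s) / n`.

* An `n`-tuple of distinct draws meets a given cube with probability at most a constant times
  `H ^ (-n)`, so the expected number of `n`-tuples that meet the covering is about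
  `H ^ (n * b + s - n)`, which tends to zero (`CellFamily.card_meeting_samples_le`). When no tuple
  does, the new set contains no point of `E` whose coordinates are `δ`-separated, as such
  coordinates lie in distinct draws (`CellFamily.avoids_of_forall_not_meeting`).
* The mean of the new measure is the old one, so that the difference of their Fourier transforms is
  the deviation of an exponential sum with `H ^ b` independent terms from its mean, times the
  transform of a single piece, which at `ξ` is at most `min (1, H / |ξ|)`
  (`CellFamily.measureFourier_sample_sub`). The deviation has period `H` in `ξ` and is Lipschitz, so
  a net of `H ^ 2` frequencies suffices to control it, and an exponential moment bound shows that it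
  is at most `η * H ^ (-t / 2)` everywhere, up to a probability that decays faster than every power
  of `H` (`card_large_discrepancy_le`). Hence the Fourier transform changes by at most
  `η * |ξ| ^ (-t / 2)`.

For large `H` the two exceptional events do not exhaust the sample space, which gives
`CellFamily.exists_refinement`. The construction runs through all pieces of `C` and all gaps, with
`t` increasing to `(n - s) / n` and summable `η`. Each `μ k` has Fourier decay of order one, so that
for every `t < (n - s) / n` the first steps are harmless and the bounds for the rest add up
to a bound for `ν`. Probabilities are expressed by counting samples `Fin m → Ω`.
-/

/-! ### Lower bounds for Fourier dimensions -/

lemma fourierDimMeasure_nonneg (μ : Measure ℝ) : 0 ≤ fourierDimMeasure μ :=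
  Real.sSup_nonneg fun _ ht => ht.1.le

lemma fourierDimMeasure_le_one (μ : Measure ℝ) : fourierDimMeasure μ ≤ 1 :=
  Real.sSup_le (fun _ ht => ht.2.1) zero_le_one

lemma fourierDim_nonneg (E : Set ℝ) : 0 ≤ fourierDim E := by
  refine Real.sSup_nonneg ?_
  rintro _ ⟨μ, -, -, -, rfl⟩
  exact fourierDimMeasure_nonneg μ

lemma le_fourierDimMeasure {μ : Measure ℝ} {β : ℝ} (hβ : β ≤ 1)
    (h : ∀ t, 0 < t → t < β → ∃ M : ℝ, ∀ ξ : ℝ, |ξ| ^ (t / 2) * ‖measureFourier μ ξ‖ ≤ M) :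
    β ≤ fourierDimMeasure μ := by
  refine le_of_forall_lt fun c hc => ?_
  rcases lt_or_ge c 0 with h0 | h0
  · exact h0.trans_le (fourierDimMeasure_nonneg μ)
  · have h1 : (c + β) / 2 ≤ fourierDimMeasure μ :=
      le_csSup ⟨1, fun _ ht => ht.2.1⟩
        ⟨by linarith, by linarith, h _ (by linarith) (by linarith)⟩
    linarith

lemma fourierDimMeasure_le_fourierDim {μ : Measure ℝ} [IsFiniteMeasure μ] (hμ : μ ≠ 0)
    {E : Set ℝ} (h : SupportedOn μ E) : fourierDimMeasure μ ≤ fourierDim E := by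
  refine le_csSup ⟨1, ?_⟩ ⟨μ, inferInstance, hμ, h, rfl⟩
  rintro _ ⟨ν, -, -, -, rfl⟩
  exact fourierDimMeasure_le_one ν

/-! ### Phases -/

/-- The phase `exp (-2πix)`. -/
noncomputable def phase (x : ℝ) : ℂ :=
  Complex.exp (-2 * (Real.pi : ℂ) * Complex.I * (x : ℂ))

lemma phase_eq (x : ℝ) : phase x = Complex.exp (((-2 * Real.pi * x : ℝ) : ℂ) * Complex.I) := by
  unfold phase; congr 1; push_cast; ring

lemma norm_phase (x : ℝ) : ‖phase x‖ = 1 := by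
  rw [phase_eq, Complex.norm_exp_ofReal_mul_I]

lemma phase_add (x y : ℝ) : phase (x + y) = phase x * phase y := by
  unfold phase; rw [← Complex.exp_add]; congr 1; push_cast; ring

lemma phase_zero : phase 0 = 1 := by simp [phase]

lemma phase_intCast (k : ℤ) : phase k = 1 := by
  rw [phase, Complex.exp_eq_one_iff]
  exact ⟨-k, by push_cast; ring⟩

lemma phase_nat_mul (k : ℕ) (x : ℝ) : phase (k * x) = phase x ^ k := by
  unfold phase; rw [← Complex.exp_nat_mul]; congr 1; push_cast; ring

@[fun_prop]
lemma continuous_phase : Continuous phase := by unfold phase; fun_prop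

lemma norm_phase_sub_le (x y : ℝ) : ‖phase x - phase y‖ ≤ 2 * Real.pi * |x - y| := by
  have h : phase x = phase y * phase (x - y) := by rw [← phase_add]; ring_nf
  rw [h, show phase y * phase (x - y) - phase y = phase y * (phase (x - y) - 1) by ring, norm_mul,
    norm_phase, one_mul, phase_eq, mul_comm _ Complex.I]
  refine (Real.norm_exp_I_mul_ofReal_sub_one_le).trans (le_of_eq ?_)
  rw [Real.norm_eq_abs, abs_mul, abs_mul, abs_of_pos Real.pi_pos]; norm_num

lemma measureFourier_eq_integral_phase (μ : Measure ℝ) (ξ : ℝ) :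
    measureFourier μ ξ = ∫ x, phase (ξ * x) ∂μ := by
  unfold measureFourier phase
  congr 1; ext x; congr 1; push_cast; ring

/-- The Fourier transform of the uniform measure on `[0, 1]`. -/
noncomputable def unitKernel (u : ℝ) : ℂ := ∫ x in Set.Icc (0 : ℝ) 1, phase (u * x)

lemma norm_unitKernel_le_one (u : ℝ) : ‖unitKernel u‖ ≤ 1 := by
  have := norm_setIntegral_le_of_norm_le_const (μ := volume) (s := Set.Icc (0 : ℝ) 1)
    (f := fun x => phase (u * x)) (C := 1) (by simp) (fun x _ => (norm_phase _).le)
  simpa [unitKernel] using this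

lemma unitKernel_mul (u : ℝ) : unitKernel u * (2 * Real.pi * Complex.I * u) = 1 - phase u := by
  rcases eq_or_ne u 0 with rfl | hu
  · simp [phase_zero]
  have hc : (-2 * (Real.pi : ℂ) * Complex.I * (u : ℂ)) ≠ 0 := by
    simp [Real.pi_ne_zero, hu, Complex.I_ne_zero]
  have : unitKernel u = (phase u - 1) / (-2 * (Real.pi : ℂ) * Complex.I * (u : ℂ)) := by
    rw [unitKernel, integral_Icc_eq_integral_Ioc, ← intervalIntegral.integral_of_le zero_le_one]
    have := integral_exp_mul_complex (a := 0) (b := 1) hc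
    simp only [Complex.ofReal_one, mul_one, Complex.ofReal_zero, mul_zero, Complex.exp_zero] at this
    rw [phase, ← this]
    congr 1; ext x; unfold phase; congr 1; push_cast; ring
  have hu' : (u : ℂ) ≠ 0 := by exact_mod_cast hu
  rw [this]
  field_simp
  ring

lemma abs_mul_norm_unitKernel_le (u : ℝ) : |u| * ‖unitKernel u‖ ≤ 1 := by
  have h := congrArg norm (unitKernel_mul u)
  have h2 : ‖1 - phase u‖ ≤ 2 := by
    refine (norm_sub_le _ _).trans ?_
    rw [norm_phase, norm_one]; norm_num
  rw [norm_mul, norm_mul, norm_mul, norm_mul, Complex.norm_I, Complex.norm_real,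
    Complex.norm_real, Real.norm_eq_abs, Real.norm_eq_abs, abs_of_pos Real.pi_pos,
    Complex.norm_ofNat] at h
  have hp := Real.pi_gt_three
  have : 0 ≤ |u| * ‖unitKernel u‖ := by positivity
  nlinarith

lemma rpow_mul_norm_unitKernel_le {a : ℝ} (h0 : 0 ≤ a) (h1 : a ≤ 1) (u : ℝ) :
    |u| ^ a * ‖unitKernel u‖ ≤ 1 := by
  rcases le_total |u| 1 with h | h
  · exact mul_le_one₀ (Real.rpow_le_one (abs_nonneg _) h h0) (norm_nonneg _)
      (norm_unitKernel_le_one u)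
  · refine le_trans ?_ (abs_mul_norm_unitKernel_le u)
    gcongr
    calc |u| ^ a ≤ |u| ^ (1 : ℝ) := Real.rpow_le_rpow_of_exponent_le h h1
      _ = |u| := Real.rpow_one _

/-- The uniform measure on `[0, 1]` is the average of its `q` translates rescaled by `1 / q`. -/
lemma unitKernel_eq_sum (q : ℕ) (u : ℝ) :
    (q : ℂ) * unitKernel (q * u) = (∑ r ∈ Finset.range q, phase (r * u)) * unitKernel u := by
  rcases eq_or_ne u 0 with rfl | hu
  · simp [phase_zero]
  have hc : (2 * (Real.pi : ℂ) * Complex.I * (u : ℂ)) ≠ 0 := by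
    simp [Real.pi_ne_zero, hu, Complex.I_ne_zero]
  apply mul_right_cancel₀ hc
  have h1 := unitKernel_mul (q * u)
  have h2 := unitKernel_mul u
  rw [mul_assoc (∑ r ∈ Finset.range q, phase (r * u)), h2]
  simp_rw [phase_nat_mul] at h1 ⊢
  rw [geom_sum_mul_neg, ← h1]
  push_cast; ring

/-! ### Weak limits of measures on nested compact sets -/

/-- Tightness gives a weak limit along an ultrafilter, and the portmanteau theorem shows that it is
carried by the intersection of the sets. -/
lemma exists_limit_measure (μ : ℕ → ProbabilityMeasure ℝ) (K : ℕ → Set ℝ)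
    (hcl : ∀ k, IsClosed (K k)) (hanti : Antitone K) (hK : K 0 ⊆ Set.Icc 0 1)
    (hμ : ∀ k, (μ k : Measure ℝ) (K k)ᶜ = 0) :
    ∃ (ν : ProbabilityMeasure ℝ) (U : Ultrafilter ℕ), (U : Filter ℕ) ≤ atTop ∧
      (ν : Measure ℝ) (⋂ k, K k)ᶜ = 0 ∧
      ∀ ξ, Tendsto (fun k => measureFourier (μ k) ξ) U (𝓝 (measureFourier ν ξ)) := by
  have hnull : ∀ j k, j ≤ k → (μ k : Measure ℝ) (K j)ᶜ = 0 := fun j k hjk =>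
    measure_mono_null (Set.compl_subset_compl.2 (hanti hjk)) (hμ k)
  set U : Ultrafilter ℕ := hyperfilter ℕ with hU
  have hUle : (U : Filter ℕ) ≤ atTop := by
    rw [← Nat.cofinite_eq_atTop]; exact hyperfilter_le_cofinite
  have htight : IsTightMeasureSet
      {((ρ : ProbabilityMeasure ℝ) : Measure ℝ) | ρ ∈ Set.range μ} := by
    rw [isTightMeasureSet_iff_exists_isCompact_measure_compl_le]
    intro ε _
    refine ⟨Set.Icc 0 1, isCompact_Icc, ?_⟩
    rintro _ ⟨_, ⟨k, rfl⟩, rfl⟩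
    rw [measure_mono_null (Set.compl_subset_compl.2 hK) (hnull 0 k (Nat.zero_le k))]
    exact zero_le
  have hcomp := isCompact_closure_of_isTightMeasureSet htight
  obtain ⟨ν, -, hν⟩ := hcomp.ultrafilter_le_nhds (U.map μ) (by
    rw [Filter.le_principal_iff, Ultrafilter.mem_coe, Ultrafilter.mem_map]
    exact Filter.univ_mem' fun k => subset_closure ⟨k, rfl⟩)
  have hlim : Tendsto μ U (𝓝 ν) := hν
  refine ⟨ν, U, hUle, ?_, fun ξ => ?_⟩
  · rw [Set.compl_iInter, measure_iUnion_null_iff]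
    intro j
    have hopen := ProbabilityMeasure.le_liminf_measure_open_of_tendsto hlim (hcl j).isOpen_compl
    have hz : liminf (fun k => (μ k : Measure ℝ) (K j)ᶜ) (U : Filter ℕ) = 0 := by
      have hev : ∀ᶠ k in (U : Filter ℕ), (μ k : Measure ℝ) (K j)ᶜ = 0 :=
        hUle ((eventually_ge_atTop j).mono fun k hk => hnull j k hk)
      rw [liminf_congr hev]; simp
    exact le_antisymm (hopen.trans hz.le) (zero_le)
  · simp_rw [measureFourier_eq_integral_phase]
    rw [ProbabilityMeasure.tendsto_iff_forall_integral_rclike_tendsto ℂ] at hlim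
    exact hlim (BoundedContinuousFunction.ofNormedAddCommGroup (fun x => phase (ξ * x))
      (by fun_prop) 1 (fun x => (norm_phase _).le))

/-! ### Counting random samples -/

section Counting

variable {Ω : Type*} [Fintype Ω]

/-- An exponential Markov inequality for the sum of `m` independent samples, in counting form: the
deviation `τ √m` has probability at most `exp (1 - τ)`. -/
lemma card_large_deviation_le [DecidableEq Ω] (g : Ω → ℝ) (hg : ∀ ω, |g ω| ≤ 1)
    (h0 : ∑ ω, g ω = 0) (m : ℕ) (hm : 0 < m) (τ : ℝ) (B : Finset (Fin m → Ω))
    (hB : ∀ f ∈ B, τ * √m ≤ ∑ j, g (f j)) :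
    (B.card : ℝ) ≤ Real.exp (1 - τ) * (Fintype.card Ω : ℝ) ^ m := by
  have hm' : (0 : ℝ) < m := by exact_mod_cast hm
  have hs : (0 : ℝ) < √m := Real.sqrt_pos.2 hm'
  have hs1 : 1 ≤ √(m : ℝ) := Real.one_le_sqrt.2 (by exact_mod_cast hm)
  set θ : ℝ := 1 / √m with hθ
  have hθ0 : 0 < θ := by positivity
  have hθ1 : θ ≤ 1 := by rw [hθ, div_le_one hs]; exact hs1
  have hθ2 : θ ^ 2 * m = 1 := by
    rw [hθ, div_pow, Real.sq_sqrt hm'.le]; field_simp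
  -- The moment generating function at `θ = 1 / √m` is at most `1 + θ² ≤ exp (1 / m)`.
  have hmgf : ∑ ω, Real.exp (θ * g ω) ≤ Fintype.card Ω * Real.exp (θ ^ 2) := by
    calc ∑ ω, Real.exp (θ * g ω) ≤ ∑ ω, (1 + θ * g ω + θ ^ 2) := by
          refine Finset.sum_le_sum fun ω _ => ?_
          have h1 : |θ * g ω| ≤ θ := by
            rw [abs_mul, abs_of_pos hθ0]; exact mul_le_of_le_one_right hθ0.le (hg ω)
          have h2 := (abs_le.1 (Real.abs_exp_sub_one_sub_id_le (h1.trans hθ1))).2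
          have h3 : (θ * g ω) ^ 2 ≤ θ ^ 2 := by
            rw [← sq_abs]; exact pow_le_pow_left₀ (abs_nonneg _) h1 2
          linarith
      _ = Fintype.card Ω * (1 + θ ^ 2) := by
          rw [Finset.sum_add_distrib, Finset.sum_add_distrib, ← Finset.mul_sum, h0]
          simp; ring
      _ ≤ _ := by
          have := Real.add_one_le_exp (θ ^ 2)
          gcongr; linarith
  have htot : ∑ f : Fin m → Ω, Real.exp (θ * ∑ j, g (f j)) ≤
      (Fintype.card Ω : ℝ) ^ m * Real.exp 1 := by
    calc ∑ f : Fin m → Ω, Real.exp (θ * ∑ j, g (f j))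
        = ∑ f : Fin m → Ω, ∏ j, Real.exp (θ * g (f j)) := by
          refine Finset.sum_congr rfl fun f _ => ?_
          rw [Finset.mul_sum, Real.exp_sum]
      _ = (∑ ω, Real.exp (θ * g ω)) ^ m := by
          rw [Fintype.sum_pow]
      _ ≤ (Fintype.card Ω * Real.exp (θ ^ 2)) ^ m := by
          refine pow_le_pow_left₀ (Finset.sum_nonneg fun _ _ => (Real.exp_pos _).le) hmgf m
      _ = (Fintype.card Ω : ℝ) ^ m * Real.exp 1 := by
          rw [mul_pow, ← Real.exp_nat_mul, mul_comm (m : ℝ), hθ2]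
  have hlow : (B.card : ℝ) * Real.exp τ ≤ ∑ f : Fin m → Ω, Real.exp (θ * ∑ j, g (f j)) := by
    calc (B.card : ℝ) * Real.exp τ = ∑ _f ∈ B, Real.exp τ := by simp
      _ ≤ ∑ f ∈ B, Real.exp (θ * ∑ j, g (f j)) := by
          refine Finset.sum_le_sum fun f hf => Real.exp_le_exp.2 ?_
          calc τ = θ * (τ * √m) := by rw [hθ]; field_simp
            _ ≤ _ := by gcongr; exact hB f hf
      _ ≤ _ := Finset.sum_le_sum_of_subset_of_nonneg (Finset.subset_univ _)
          fun _ _ _ => (Real.exp_pos _).le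
  rw [Real.exp_sub, div_mul_eq_mul_div, le_div_iff₀ (Real.exp_pos _)]
  linarith

/-- Prescribing `n` distinct samples to lie in given sets of at most `b` elements. -/
lemma card_prescribed_le [Nonempty Ω] {n m : ℕ} (j : Fin n → Fin m) (hj : Function.Injective j)
    (S : Fin n → Finset Ω) (b : ℝ) (hS : ∀ i, ((S i).card : ℝ) ≤ b) (B : Finset (Fin m → Ω))
    (hB : ∀ f ∈ B, ∀ i, f (j i) ∈ S i) :
    (B.card : ℝ) ≤ (b / Fintype.card Ω) ^ n * (Fintype.card Ω : ℝ) ^ m := by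
  classical
  have hc : (0 : ℝ) < Fintype.card Ω := by exact_mod_cast Fintype.card_pos
  let T : Fin m → Finset Ω := fun k => Finset.univ.filter fun ω => ∀ i, j i = k → ω ∈ S i
  have hsub : B ⊆ Fintype.piFinset T := by
    intro f hf
    rw [Fintype.mem_piFinset]
    intro k
    simp only [T, Finset.mem_filter, Finset.mem_univ, true_and]
    rintro i rfl
    exact hB f hf i
  have h1 : (B.card : ℝ) ≤ ∏ k, ((T k).card : ℝ) := by
    have := Finset.card_le_card hsub
    rw [Fintype.card_piFinset] at this
    exact_mod_cast this
  have h2 : ∏ k, ((T k).card : ℝ) / Fintype.card Ω =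
      ∏ i, ((S i).card : ℝ) / Fintype.card Ω := by
    rw [← Finset.prod_subset (Finset.subset_univ (Finset.univ.image j)),
      Finset.prod_image (fun _ _ _ _ h => hj h)]
    · refine Finset.prod_congr rfl fun i _ => ?_
      have : T (j i) = S i := by
        ext ω
        simp only [T, Finset.mem_filter, Finset.mem_univ, true_and]
        exact ⟨fun h => h i rfl, fun h i' hi' => hj hi' ▸ h⟩
      rw [this]
    · intro k _ hk
      have : T k = Finset.univ := by
        refine Finset.filter_true_of_mem fun ω _ i hi => ?_
        exact absurd (Finset.mem_image.2 ⟨i, Finset.mem_univ _, hi⟩) hk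
      rw [this, Finset.card_univ, div_self hc.ne']
  have h3 : ∏ k, ((T k).card : ℝ) =
      (∏ i, ((S i).card : ℝ) / Fintype.card Ω) * (Fintype.card Ω : ℝ) ^ m := by
    rw [← h2, Finset.prod_div_distrib, Finset.prod_const, Finset.card_univ, Fintype.card_fin,
      div_mul_cancel₀ _ (pow_ne_zero _ hc.ne')]
  rw [h3] at h1
  refine h1.trans ?_
  gcongr
  calc ∏ i, ((S i).card : ℝ) / Fintype.card Ω ≤ ∏ _i : Fin n, b / Fintype.card Ω := by
        refine Finset.prod_le_prod (fun i _ => by positivity) fun i _ => ?_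
        gcongr; exact hS i
    _ = _ := by rw [Finset.prod_const, Finset.card_univ, Fintype.card_fin]

/-- The difference at frequency `ξ` between the exponential sum over the sample `f` and its mean,
for the points `c ω / H`. -/
noncomputable def discrepancy (c : Ω → ℕ) (H m : ℕ) (f : Fin m → Ω) (ξ : ℝ) : ℂ :=
  (m : ℂ)⁻¹ * ∑ j, phase (ξ * (c (f j) / H)) -
    (Fintype.card Ω : ℂ)⁻¹ * ∑ ω, phase (ξ * (c ω / H))

lemma norm_inv_card_mul_sum_le {ι : Type*} [Fintype ι] (g : ι → ℂ) {b : ℝ} (hb : 0 ≤ b)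
    (hg : ∀ i, ‖g i‖ ≤ b) : ‖(Fintype.card ι : ℂ)⁻¹ * ∑ i, g i‖ ≤ b := by
  rw [norm_mul, norm_inv, Complex.norm_natCast]
  rcases (Nat.cast_nonneg (α := ℝ) (Fintype.card ι)).eq_or_lt with h | h
  · rw [← h]; simpa using hb
  rw [inv_mul_le_iff₀ h]
  calc ‖∑ i, g i‖ ≤ ∑ i, ‖g i‖ := norm_sum_le _ _
    _ ≤ ∑ _i : ι, b := Finset.sum_le_sum fun i _ => hg i
    _ = _ := by simp

lemma norm_discrepancy_sub_le {c : Ω → ℕ} {H : ℕ} (hH : 0 < H) (hc : ∀ ω, c ω ≤ H) {m : ℕ}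
    (f : Fin m → Ω) (ξ ξ' : ℝ) :
    ‖discrepancy c H m f ξ - discrepancy c H m f ξ'‖ ≤ 4 * Real.pi * |ξ - ξ'| := by
  have hH' : (0 : ℝ) < H := by exact_mod_cast hH
  have key : ∀ ω, ‖phase (ξ * (c ω / H)) - phase (ξ' * (c ω / H))‖ ≤ 2 * Real.pi * |ξ - ξ'| := by
    intro ω
    refine (norm_phase_sub_le _ _).trans ?_
    have hc' : (c ω : ℝ) / H ≤ 1 := by rw [div_le_one hH']; exact_mod_cast hc ω
    rw [← sub_mul, abs_mul, abs_of_nonneg (show (0 : ℝ) ≤ c ω / H by positivity)]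
    have := mul_le_of_le_one_right (abs_nonneg (ξ - ξ')) hc'
    gcongr
  have e : discrepancy c H m f ξ - discrepancy c H m f ξ' =
      (Fintype.card (Fin m) : ℂ)⁻¹ *
        ∑ j, (phase (ξ * (c (f j) / H)) - phase (ξ' * (c (f j) / H))) -
      (Fintype.card Ω : ℂ)⁻¹ * ∑ ω, (phase (ξ * (c ω / H)) - phase (ξ' * (c ω / H))) := by
    simp only [discrepancy, Finset.sum_sub_distrib, Fintype.card_fin]; ring
  rw [e]
  have hb : 0 ≤ 2 * Real.pi * |ξ - ξ'| := by positivity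
  refine (norm_sub_le _ _).trans ?_
  have h1 := norm_inv_card_mul_sum_le (fun j => phase (ξ * (c (f j) / H)) -
    phase (ξ' * (c (f j) / H))) hb (fun j => key _)
  have h2 := norm_inv_card_mul_sum_le (fun ω => phase (ξ * (c ω / H)) -
    phase (ξ' * (c ω / H))) hb key
  linarith

lemma discrepancy_add_int_mul (c : Ω → ℕ) {H : ℕ} (hH : 0 < H) {m : ℕ} (f : Fin m → Ω) (ξ : ℝ)
    (k : ℤ) : discrepancy c H m f (ξ + k * H) = discrepancy c H m f ξ := by
  have hH' : (H : ℝ) ≠ 0 := by exact_mod_cast hH.ne'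
  have key : ∀ ω, phase ((ξ + k * H) * (c ω / H)) = phase (ξ * (c ω / H)) := by
    intro ω
    have : (ξ + k * H) * (c ω / H) = ξ * (c ω / H) + ((k * c ω : ℤ) : ℝ) := by
      push_cast; field_simp
    rw [this, phase_add, phase_intCast, mul_one]
  simp only [discrepancy, key]

/-- Control of the discrepancy on the net `p / H`, `p < H²`, of one period gives control
everywhere. -/
lemma norm_discrepancy_le_of_net {c : Ω → ℕ} {H : ℕ} (hH : 0 < H) (hc : ∀ ω, c ω ≤ H) {m : ℕ}
    (f : Fin m → Ω) {Λ : ℝ} (hΛ : 26 ≤ Λ * H)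
    (hnet : ∀ p < H ^ 2, ‖discrepancy c H m f (p / H)‖ ≤ Λ / 2) (ξ : ℝ) :
    ‖discrepancy c H m f ξ‖ ≤ Λ := by
  have hH' : (0 : ℝ) < H := by exact_mod_cast hH
  have hHz : (0 : ℤ) < (H : ℤ) ^ 2 := by positivity
  set z : ℤ := ⌊ξ * H⌋ with hz
  have hclose : |ξ - z / H| ≤ 1 / H := by
    have h1 := Int.floor_le (ξ * H)
    have h2 := Int.lt_floor_add_one (ξ * H)
    have e : ξ - z / H = (ξ * H - z) / H := by field_simp
    rw [e, abs_div, abs_of_pos hH']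
    gcongr
    rw [abs_le]; constructor <;> linarith
  obtain ⟨p, hp⟩ := Int.eq_ofNat_of_zero_le (Int.emod_nonneg z hHz.ne')
  have hplt : p < H ^ 2 := by
    have := Int.emod_lt_of_pos z hHz
    rw [hp] at this; exact_mod_cast this
  have hzp : (z : ℝ) / H = p / H + ((z / (H : ℤ) ^ 2 : ℤ) : ℝ) * H := by
    have := Int.emod_add_mul_ediv z ((H : ℤ) ^ 2)
    rw [hp] at this
    have h3 : (z : ℝ) = p + (H : ℝ) ^ 2 * ((z / (H : ℤ) ^ 2 : ℤ) : ℝ) := by exact_mod_cast this.symm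
    field_simp
    linarith
  have h1 : ‖discrepancy c H m f (z / H)‖ ≤ Λ / 2 := by
    rw [hzp, discrepancy_add_int_mul c hH]; exact hnet p hplt
  have h2 := norm_discrepancy_sub_le hH hc f ξ (z / H)
  have h3 : 4 * Real.pi * |ξ - z / H| ≤ Λ / 2 := by
    calc 4 * Real.pi * |ξ - z / H| ≤ 4 * Real.pi * (1 / H) := by gcongr
      _ ≤ Λ / 2 := by
        rw [mul_one_div, div_le_iff₀ hH']
        have := Real.pi_lt_d2
        linarith
  calc ‖discrepancy c H m f ξ‖
      = ‖(discrepancy c H m f ξ - discrepancy c H m f (z / H)) + discrepancy c H m f (z / H)‖ := by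
        rw [sub_add_cancel]
    _ ≤ _ := norm_add_le _ _
    _ ≤ Λ := by linarith

lemma exists_re_I_pow_mul_gt {w : ℂ} {a : ℝ} (h : 2 * a < ‖w‖) :
    ∃ k ∈ Finset.range 4, a < (Complex.I ^ k * w).re := by
  by_contra! hcon
  have h0 := hcon 0 (by simp)
  have h1 := hcon 1 (by simp)
  have h2 := hcon 2 (by simp)
  have h3 := hcon 3 (by simp)
  simp [pow_succ] at h0 h1 h2 h3
  have := Complex.norm_le_abs_re_add_abs_im w
  have hr : |w.re| ≤ a := abs_le.2 ⟨by linarith, by linarith⟩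
  have hi : |w.im| ≤ a := abs_le.2 ⟨by linarith, by linarith⟩
  linarith

/-- Few samples have a discrepancy exceeding `Λ` at some frequency: the union bound over the net
of `H²` frequencies and over the four half-planes `Re (Iᵏ w) > Λ / 4`. -/
lemma card_large_discrepancy_le [Nonempty Ω] {c : Ω → ℕ} {H : ℕ} (hH : 0 < H)
    (hc : ∀ ω, c ω ≤ H) {m : ℕ} (hm : 0 < m) {Λ : ℝ} (hΛ : 26 ≤ Λ * H)
    (B : Finset (Fin m → Ω)) (hB : ∀ f ∈ B, ∃ ξ, Λ < ‖discrepancy c H m f ξ‖) :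
    (B.card : ℝ) ≤ 4 * H ^ 2 * Real.exp (1 - Λ * √m / 8) * (Fintype.card Ω : ℝ) ^ m := by
  classical
  have hm' : (0 : ℝ) < m := by exact_mod_cast hm
  have hN : (0 : ℝ) < Fintype.card Ω := by exact_mod_cast Fintype.card_pos
  let A : ℕ × ℕ → Finset (Fin m → Ω) := fun pk =>
    Finset.univ.filter fun f => Λ / 4 < (Complex.I ^ pk.2 * discrepancy c H m f (pk.1 / H)).re
  have hsub : B ⊆ (Finset.range (H ^ 2) ×ˢ Finset.range 4).biUnion A := by
    intro f hf
    obtain ⟨ξ, hξ⟩ := hB f hf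
    have : ∃ p < H ^ 2, Λ / 2 < ‖discrepancy c H m f (p / H)‖ := by
      by_contra! hcon
      exact absurd (norm_discrepancy_le_of_net hH hc f hΛ hcon ξ) (not_le.2 hξ)
    obtain ⟨p, hp, hpΛ⟩ := this
    obtain ⟨k, hk, hkΛ⟩ := exists_re_I_pow_mul_gt (a := Λ / 4)
      (w := discrepancy c H m f (p / H)) (by linarith)
    exact Finset.mem_biUnion.2 ⟨(p, k), Finset.mk_mem_product (Finset.mem_range.2 hp) hk,
      Finset.mem_filter.2 ⟨Finset.mem_univ _, hkΛ⟩⟩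
  have hA : ∀ pk, ((A pk).card : ℝ) ≤
      Real.exp (1 - Λ * √m / 8) * (Fintype.card Ω : ℝ) ^ m := by
    rintro ⟨p, k⟩
    set φ : Ω → ℂ := fun ω => phase (p / H * (c ω / H)) with hφ
    set avg : ℂ := (Fintype.card Ω : ℂ)⁻¹ * ∑ ω, φ ω with havg
    have havg1 : ‖avg‖ ≤ 1 := norm_inv_card_mul_sum_le φ zero_le_one fun ω => (norm_phase _).le
    refine card_large_deviation_le (fun ω => (Complex.I ^ k * (φ ω - avg)).re / 2) ?_ ?_ m hm _ _ ?_
    · intro ω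
      rw [abs_div, abs_two, div_le_one two_pos]
      refine (Complex.abs_re_le_norm _).trans ?_
      rw [norm_mul, norm_pow, Complex.norm_I, one_pow, one_mul]
      refine (norm_sub_le _ _).trans ?_
      have : ‖φ ω‖ = 1 := norm_phase _
      linarith
    · rw [← Finset.sum_div, ← Complex.re_sum, ← Finset.mul_sum, Finset.sum_sub_distrib]
      have : ∑ _ω : Ω, avg = ∑ ω, φ ω := by
        rw [Finset.sum_const, Finset.card_univ, nsmul_eq_mul, havg, ← mul_assoc,
          mul_inv_cancel₀ (by exact_mod_cast hN.ne'), one_mul]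
      rw [this]; simp
    · intro f hf
      have hf' := (Finset.mem_filter.1 hf).2
      have e : ∑ j, (Complex.I ^ k * (φ (f j) - avg)).re / 2 =
          m * (Complex.I ^ k * discrepancy c H m f (p / H)).re / 2 := by
        rw [← Finset.sum_div, ← Complex.re_sum, ← Finset.mul_sum, Finset.sum_sub_distrib]
        have : (∑ j, φ (f j) - ∑ _j : Fin m, avg) = m * discrepancy c H m f (p / H) := by
          rw [discrepancy, mul_sub, ← mul_assoc, mul_inv_cancel₀ (by exact_mod_cast hm.ne'),
            one_mul, Finset.sum_const, Finset.card_univ, nsmul_eq_mul, Fintype.card_fin]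
        rw [this, mul_left_comm, ← Complex.ofReal_natCast, Complex.re_ofReal_mul]
      rw [e, div_mul_eq_mul_div, mul_assoc, Real.mul_self_sqrt hm'.le]
      dsimp only at hf'
      nlinarith
  calc (B.card : ℝ) ≤ (((Finset.range (H ^ 2) ×ˢ Finset.range 4).biUnion A).card : ℝ) := by
        exact_mod_cast Finset.card_le_card hsub
    _ ≤ ∑ pk ∈ Finset.range (H ^ 2) ×ˢ Finset.range 4, ((A pk).card : ℝ) := by
        exact_mod_cast Finset.card_biUnion_le
    _ ≤ ∑ _pk ∈ Finset.range (H ^ 2) ×ˢ Finset.range 4,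
          Real.exp (1 - Λ * √m / 8) * (Fintype.card Ω : ℝ) ^ m :=
        Finset.sum_le_sum fun pk _ => hA pk
    _ = _ := by
        rw [Finset.sum_const, Finset.card_product, Finset.card_range, Finset.card_range,
          nsmul_eq_mul]
        push_cast; ring

end Counting

/-! ### Covering numbers -/

/-- For a bounded set the infimum defining the covering number is over a nonempty set, hence
attained. -/
lemma exists_cover_card_eq {n : ℕ} {E : Set (Fin n → ℝ)} (hE : Bornology.IsBounded E) {l : ℝ}
    (hl : 0 < l) : ∃ T : Finset (Fin n → ℝ), T.card = cubeCoveringNumber l E ∧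
      E ⊆ ⋃ a ∈ T, sideCube a l := by
  classical
  refine Nat.sInf_mem (s := {m : ℕ | ∃ t : Finset (Fin n → ℝ), t.card = m ∧
    E ⊆ ⋃ a ∈ t, sideCube a l}) ?_
  have htb : TotallyBounded E := hE.isCompact_closure.totallyBounded.subset subset_closure
  obtain ⟨t, ht, hcov⟩ := Metric.totallyBounded_iff.1 htb (l / 2) (by positivity)
  refine ⟨_, ht.toFinset.image (fun y i => y i - l / 2), rfl, fun x hx => ?_⟩
  obtain ⟨y, hy, hxy⟩ := Set.mem_iUnion₂.1 (hcov hx)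
  refine Set.mem_iUnion₂.2 ⟨_, Finset.mem_image_of_mem _ (ht.mem_toFinset.2 hy), fun i => ?_⟩
  have h1 := (dist_le_pi_dist x y i).trans (Metric.mem_ball.1 hxy).le
  rw [Real.dist_eq, abs_le] at h1
  constructor <;> linarith [h1.1, h1.2]

lemma frequently_covering_le {n : ℕ} {E : Set (Fin n → ℝ)} {s s' : ℝ} (hs : s < s')
    (hdim : lowerMinkowskiDim E ≤ (s : EReal)) :
    ∃ᶠ l : ℝ in 𝓝[>] 0, (cubeCoveringNumber l E : ℝ) ≤ (1 / l) ^ s' := by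
  have h1 : lowerMinkowskiDim E < (s' : EReal) := hdim.trans_lt (by exact_mod_cast hs)
  have h2 := frequently_lt_of_liminf_lt (by isBoundedDefault) h1
  have h3 : ∀ᶠ l : ℝ in 𝓝[>] 0, 0 < l ∧ l < 1 := Ioo_mem_nhdsGT one_pos
  refine (h2.and_eventually h3).mono ?_
  rintro l ⟨hl, h0, hl1⟩
  have hlog : 0 < Real.log (1 / l) := Real.log_pos (by rw [lt_div_iff₀ h0]; linarith)
  have hl' : Real.log (cubeCoveringNumber l E) / Real.log (1 / l) < s' := by exact_mod_cast hl
  rw [div_lt_iff₀ hlog] at hl'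
  rcases Nat.eq_zero_or_pos (cubeCoveringNumber l E) with h | h
  · rw [h, Nat.cast_zero]; positivity
  · rw [← Real.log_le_log_iff (by exact_mod_cast h) (by positivity),
      Real.log_rpow (by positivity)]
    exact hl'.le

/-! ### Families of cells -/

/-- A nonempty finite family, with multiplicities, of the closed cells `[p / res, (p + 1) / res]`,
`p < res`, of the grid of mesh `1 / res` in `[0, 1]`; `pos j` is the index of the `j`-th cell. -/
structure CellFamily where
  res : ℕ
  card : ℕ
  pos : Fin card → ℕ
  card_pos : 0 < card
  pos_lt : ∀ j, pos j < res

namespace CellFamily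

variable (σ : CellFamily)

lemma res_pos : 0 < σ.res := (Nat.zero_le _).trans_lt (σ.pos_lt ⟨0, σ.card_pos⟩)

/-- The union of the cells of the family. -/
def support : Set ℝ :=
  ⋃ j, Set.Icc ((σ.pos j : ℝ) / σ.res) (((σ.pos j : ℝ) + 1) / σ.res)

lemma isClosed_support : IsClosed σ.support :=
  isClosed_iUnion_of_finite fun _ => isClosed_Icc

lemma support_subset : σ.support ⊆ Set.Icc 0 1 := by
  have hQ : (0 : ℝ) < σ.res := by exact_mod_cast σ.res_pos
  refine Set.iUnion_subset fun j => Set.Icc_subset_Icc (by positivity) ?_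
  rw [div_le_one hQ]
  exact_mod_cast σ.pos_lt j

/-- The average, over the cells of the family, of the uniform probability measures on the cells. -/
noncomputable def toMeasure : Measure ℝ :=
  (σ.card : ENNReal)⁻¹ • ∑ j : Fin σ.card, (volume.restrict (Set.Icc (0 : ℝ) 1)).map
    fun x : ℝ => (σ.pos j + x) / σ.res

lemma measurable_cell (j : Fin σ.card) : Measurable fun x : ℝ => (σ.pos j + x) / σ.res := by
  fun_prop

instance : IsProbabilityMeasure σ.toMeasure := by
  constructor
  have hc : (σ.card : ENNReal) ≠ 0 := by exact_mod_cast σ.card_pos.ne'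
  have : ∀ j : Fin σ.card, (volume.restrict (Set.Icc (0 : ℝ) 1)).map
      (fun x : ℝ => (σ.pos j + x) / σ.res) Set.univ = 1 := fun j => by
    rw [Measure.map_apply (σ.measurable_cell j) MeasurableSet.univ]; simp
  simp only [toMeasure, Measure.smul_apply, Measure.finsetSum_apply, this, smul_eq_mul]
  simp [ENNReal.inv_mul_cancel hc]

lemma measure_compl_support : σ.toMeasure σ.supportᶜ = 0 := by
  have hQ : (0 : ℝ) < σ.res := by exact_mod_cast σ.res_pos
  have : ∀ j : Fin σ.card, (volume.restrict (Set.Icc (0 : ℝ) 1)).map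
      (fun x : ℝ => (σ.pos j + x) / σ.res) σ.supportᶜ = 0 := fun j => by
    rw [Measure.map_apply (σ.measurable_cell j) σ.isClosed_support.measurableSet.compl]
    refine measure_mono_null ?_ (Measure.restrict_apply_eq_zero' measurableSet_Icc |>.2
      (Set.compl_inter_self (Set.Icc (0 : ℝ) 1) ▸ measure_empty) :
        volume.restrict (Set.Icc (0 : ℝ) 1) (Set.Icc (0 : ℝ) 1)ᶜ = 0)
    intro x hx hx01
    refine hx (Set.mem_iUnion.2 ⟨j, ?_⟩)
    constructor
    · exact div_le_div_of_nonneg_right (by linarith [hx01.1]) hQ.le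
    · exact div_le_div_of_nonneg_right (by linarith [hx01.2]) hQ.le
  simp [toMeasure, Measure.smul_apply, Measure.finsetSum_apply, this]

lemma measureFourier_toMeasure (ξ : ℝ) : measureFourier σ.toMeasure ξ =
    ((σ.card : ℂ)⁻¹ * ∑ j, phase (ξ * (σ.pos j / σ.res))) * unitKernel (ξ / σ.res) := by
  have hint : ∀ j : Fin σ.card, Integrable (fun x => phase (ξ * x))
      ((volume.restrict (Set.Icc (0 : ℝ) 1)).map fun x : ℝ => (σ.pos j + x) / σ.res) := by
    intro j
    refine (integrable_map_measure (by fun_prop) (by fun_prop)).2 ?_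
    exact (show Continuous ((fun x => phase (ξ * x)) ∘ fun x : ℝ => (σ.pos j + x) / σ.res) by
      fun_prop).integrableOn_Icc
  have hj : ∀ j : Fin σ.card, ∫ x, phase (ξ * x)
      ∂((volume.restrict (Set.Icc (0 : ℝ) 1)).map fun x : ℝ => (σ.pos j + x) / σ.res) =
      phase (ξ * (σ.pos j / σ.res)) * unitKernel (ξ / σ.res) := by
    intro j
    rw [integral_map (by fun_prop) (by fun_prop), unitKernel, ← integral_const_mul]
    congr 1; ext x
    rw [← phase_add]; congr 1; ring
  rw [measureFourier_eq_integral_phase, toMeasure, integral_smul_measure,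
    integral_finsetSum_measure fun j _ => hint j]
  simp only [hj, ← Finset.sum_mul, ENNReal.toReal_inv, ENNReal.toReal_natCast]
  rw [Complex.real_smul]; push_cast; ring

/-- The measure of a single family has Fourier decay of order one, with a constant depending on the
family. -/
lemma rpow_mul_norm_measureFourier_le {a : ℝ} (h0 : 0 ≤ a) (h1 : a ≤ 1) (ξ : ℝ) :
    |ξ| ^ a * ‖measureFourier σ.toMeasure ξ‖ ≤ (σ.res : ℝ) ^ a := by
  have hQ : (0 : ℝ) < σ.res := by exact_mod_cast σ.res_pos
  have havg := norm_inv_card_mul_sum_le (fun j => phase (ξ * (σ.pos j / σ.res))) zero_le_one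
    fun j => (norm_phase _).le
  rw [Fintype.card_fin] at havg
  have hk := rpow_mul_norm_unitKernel_le h0 h1 (ξ / σ.res)
  rw [abs_div, abs_of_pos hQ, Real.div_rpow (abs_nonneg _) hQ.le, div_mul_eq_mul_div,
    div_le_iff₀ (by positivity), one_mul] at hk
  rw [measureFourier_toMeasure, norm_mul]
  refine le_trans ?_ hk
  gcongr
  exact mul_le_of_le_one_left (norm_nonneg _) havg

/-- The index, in the grid of mesh `1 / (res * q)`, of the `r`-th of the `q` pieces of the `i`-th
cell. -/
def subcell (q : ℕ) (ω : Fin σ.card × Fin q) : ℕ := σ.pos ω.1 * q + ω.2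

lemma subcell_lt {q : ℕ} (ω : Fin σ.card × Fin q) : σ.subcell q ω < σ.res * q := by
  have h1 : σ.pos ω.1 + 1 ≤ σ.res := σ.pos_lt ω.1
  have h2 := ω.2.isLt
  calc σ.pos ω.1 * q + ω.2 < (σ.pos ω.1 + 1) * q := by rw [add_mul, one_mul]; omega
    _ ≤ _ := Nat.mul_le_mul_right q h1

/-- The family of the pieces selected by the sample `f`, each cell being cut into `q` pieces. -/
def sample {q m : ℕ} (hm : 0 < m) (f : Fin m → Fin σ.card × Fin q) : CellFamily where
  res := σ.res * q
  card := m
  pos j := σ.subcell q (f j)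
  card_pos := hm
  pos_lt j := σ.subcell_lt (f j)

lemma support_sample_subset {q m : ℕ} (hm : 0 < m) (f : Fin m → Fin σ.card × Fin q) :
    (σ.sample hm f).support ⊆ σ.support := by
  refine Set.iUnion_subset fun j => ?_
  refine Set.Subset.trans ?_ (Set.subset_iUnion _ (f j).1)
  have hQ : (0 : ℝ) < σ.res := by exact_mod_cast σ.res_pos
  have hr := (f j).2.isLt
  have hq : (0 : ℝ) < q := by exact_mod_cast (Nat.zero_le _).trans_lt hr
  have hr' : (((f j).2 : ℕ) : ℝ) + 1 ≤ q := by exact_mod_cast hr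
  simp only [sample, subcell]
  push_cast
  refine Set.Icc_subset_Icc ?_ ?_
  · rw [div_le_div_iff₀ hQ (by positivity)]
    have : (0 : ℝ) ≤ ((f j).2 : ℕ) := by positivity
    nlinarith
  · rw [div_le_div_iff₀ (by positivity) hQ]
    nlinarith

/-- Cutting the cells does not change the measure: its Fourier transform in terms of the pieces. -/
lemma measureFourier_eq_mean_subcell {q : ℕ} (hq : 0 < q) (ξ : ℝ) :
    measureFourier σ.toMeasure ξ =
      ((Fintype.card (Fin σ.card × Fin q) : ℂ)⁻¹ *
        ∑ ω : Fin σ.card × Fin q, phase (ξ * (σ.subcell q ω / (σ.res * q : ℕ)))) *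
        unitKernel (ξ / (σ.res * q : ℕ)) := by
  have hQ : (σ.res : ℝ) ≠ 0 := by exact_mod_cast σ.res_pos.ne'
  have hq' : (q : ℝ) ≠ 0 := by exact_mod_cast hq.ne'
  have hqc : (q : ℂ) ≠ 0 := by exact_mod_cast hq.ne'
  set u : ℝ := ξ / (σ.res * q : ℕ) with hu
  have hsum : ∑ ω : Fin σ.card × Fin q, phase (ξ * (σ.subcell q ω / (σ.res * q : ℕ))) =
      (∑ j, phase (ξ * (σ.pos j / σ.res))) * ∑ r ∈ Finset.range q, phase (r * u) := by
    rw [Fintype.sum_prod_type, Finset.sum_mul]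
    refine Finset.sum_congr rfl fun j _ => ?_
    rw [Finset.sum_range, Finset.mul_sum]
    refine Finset.sum_congr rfl fun r _ => ?_
    rw [← phase_add, hu, subcell]
    congr 1; push_cast; field_simp
  have hk := unitKernel_eq_sum q u
  have hqu : (q : ℝ) * u = ξ / σ.res := by rw [hu]; push_cast; field_simp
  rw [hqu] at hk
  rw [measureFourier_toMeasure, hsum, Fintype.card_prod, Fintype.card_fin, Fintype.card_fin,
    mul_assoc _ _ (unitKernel u), mul_assoc _ _ (unitKernel u), ← hk]
  push_cast
  field_simp

lemma measureFourier_sample_sub {q m : ℕ} (hq : 0 < q) (hm : 0 < m)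
    (f : Fin m → Fin σ.card × Fin q) (ξ : ℝ) :
    measureFourier (σ.sample hm f).toMeasure ξ - measureFourier σ.toMeasure ξ =
      discrepancy (σ.subcell q) (σ.res * q) m f ξ * unitKernel (ξ / (σ.res * q : ℕ)) := by
  rw [measureFourier_toMeasure, σ.measureFourier_eq_mean_subcell hq, discrepancy, sub_mul]
  rfl

lemma subcell_injective_pair {q : ℕ} :
    Function.Injective fun ω : Fin σ.card × Fin q => (σ.subcell q ω, ω.1) := by
  rintro ⟨i, r⟩ ⟨i', r'⟩ h
  simp only [subcell, Prod.mk.injEq] at h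
  obtain ⟨h1, rfl⟩ := h
  simp only [Prod.mk.injEq, true_and]
  exact Fin.ext (by omega)

open Classical in
/-- The pieces that meet the interval `[a, a + l]`. -/
noncomputable def meeting (q : ℕ) (a l : ℝ) : Finset (Fin σ.card × Fin q) :=
  Finset.univ.filter fun ω =>
    (σ.subcell q ω : ℝ) / (σ.res * q : ℕ) ≤ a + l ∧
      a ≤ ((σ.subcell q ω : ℝ) + 1) / (σ.res * q : ℕ)

/-- An interval no longer than a piece meets pieces in at most three positions. -/
lemma card_meeting_le {q : ℕ} (hq : 0 < q) {a l : ℝ} (hl : l * (σ.res * q : ℕ) ≤ 1) :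
    (σ.meeting q a l).card ≤ 3 * σ.card := by
  have hH : (0 : ℝ) < (σ.res * q : ℕ) := by exact_mod_cast Nat.mul_pos σ.res_pos hq
  set H : ℝ := ((σ.res * q : ℕ) : ℝ) with hHdef
  set c₀ : ℕ := ⌈a * H - 1⌉₊ with hc₀
  calc (σ.meeting q a l).card
      ≤ ((Finset.Icc c₀ (c₀ + 2)) ×ˢ (Finset.univ : Finset (Fin σ.card))).card := by
        refine Finset.card_le_card_of_injOn (fun ω => (σ.subcell q ω, ω.1)) ?_
          (σ.subcell_injective_pair.injOn)
        intro ω hω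
        obtain ⟨h1, h2⟩ := (Finset.mem_filter.1 hω).2
        rw [← hHdef] at h1 h2
        rw [div_le_iff₀ hH] at h1
        rw [le_div_iff₀ hH] at h2
        have h3 : c₀ ≤ σ.subcell q ω := Nat.ceil_le.2 (by linarith)
        have h4 := Nat.le_ceil (a * H - 1)
        have h5 : (σ.subcell q ω : ℝ) ≤ c₀ + 2 := by rw [hc₀]; nlinarith
        have h6 : σ.subcell q ω ≤ c₀ + 2 := by exact_mod_cast h5
        simp [h3, h6]
    _ = 3 * σ.card := by
        rw [Finset.card_product, Nat.card_Icc, Finset.card_univ, Fintype.card_fin,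
          show c₀ + 2 + 1 - c₀ = 3 by omega]

/-- A sample, none of whose `n`-tuples of distinct pieces meets a cube of a covering of `E`, avoids
the configurations of `E` whose entries are further apart than the length of the pieces. -/
lemma avoids_of_forall_not_meeting {q m n : ℕ} (hq : 0 < q) (hm : 0 < m)
    (f : Fin m → Fin σ.card × Fin q) {E : Set (Fin n → ℝ)} {l δ : ℝ}
    {T : Finset (Fin n → ℝ)} (hT : E ⊆ ⋃ a ∈ T, sideCube a l)
    (hδ : 1 / ((σ.res * q : ℕ) : ℝ) < δ)
    (hf : ∀ j : Fin n → Fin m, Function.Injective j → ∀ a ∈ T,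
      ∃ i, f (j i) ∉ σ.meeting q (a i) l) :
    ∀ x ∈ E, (∀ i i', i ≠ i' → δ ≤ |x i - x i'|) → ∃ i, x i ∉ (σ.sample hm f).support := by
  intro x hx hsep
  by_contra! hcon
  have hH : (0 : ℝ) < (σ.res * q : ℕ) := by exact_mod_cast Nat.mul_pos σ.res_pos hq
  choose j hj using fun i => Set.mem_iUnion.1 (hcon i)
  have hjinj : Function.Injective j := by
    intro i i' hii
    by_contra hne
    have h1 := hj i
    have h2 := hj i'
    rw [← hii] at h2
    have h3 := hsep i i' hne
    have h4 : |x i - x i'| ≤ 1 / ((σ.res * q : ℕ) : ℝ) := by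
      simp only [sample, add_div, Set.mem_Icc] at h1 h2
      rw [abs_le]
      constructor <;> linarith [h1.1, h1.2, h2.1, h2.2]
    linarith
  obtain ⟨a, ha, hxa⟩ := Set.mem_iUnion₂.1 (hT hx)
  obtain ⟨i, hi⟩ := hf j hjinj a ha
  refine hi (Finset.mem_filter.2 ⟨Finset.mem_univ _, ?_, ?_⟩)
  · exact (hj i).1.trans (hxa i).2
  · exact (hxa i).1.trans (hj i).2

open Classical in
/-- Few samples have an `n`-tuple of distinct pieces that meets a cube of a covering. -/
lemma card_meeting_samples_le {q m n : ℕ} (hq : 0 < q) {l : ℝ}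
    (hl : l * (σ.res * q : ℕ) ≤ 1) (T : Finset (Fin n → ℝ)) :
    ((Finset.univ.filter fun f : Fin m → Fin σ.card × Fin q =>
      ∃ j : Fin n → Fin m, Function.Injective j ∧ ∃ a ∈ T,
        ∀ i, f (j i) ∈ σ.meeting q (a i) l).card : ℝ) ≤
      (m : ℝ) ^ n * T.card * (3 / q) ^ n * (Fintype.card (Fin σ.card × Fin q) : ℝ) ^ m := by
  have : NeZero σ.card := ⟨σ.card_pos.ne'⟩
  have : NeZero q := ⟨hq.ne'⟩
  have hM : (0 : ℝ) < σ.card := by exact_mod_cast σ.card_pos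
  let A : (Fin n → Fin m) × (Fin n → ℝ) → Finset (Fin m → Fin σ.card × Fin q) := fun ja =>
    Finset.univ.filter fun f => Function.Injective ja.1 ∧
      ∀ i, f (ja.1 i) ∈ σ.meeting q (ja.2 i) l
  set F := Finset.univ.filter fun f : Fin m → Fin σ.card × Fin q =>
      ∃ j : Fin n → Fin m, Function.Injective j ∧ ∃ a ∈ T,
        ∀ i, f (j i) ∈ σ.meeting q (a i) l with hF
  have hsub : F ⊆ ((Finset.univ : Finset (Fin n → Fin m)) ×ˢ T).biUnion A := by
    intro f hf
    obtain ⟨j, hj, a, ha, h⟩ := (Finset.mem_filter.1 hf).2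
    exact Finset.mem_biUnion.2 ⟨(j, a), Finset.mk_mem_product (Finset.mem_univ _) ha,
      Finset.mem_filter.2 ⟨Finset.mem_univ _, hj, h⟩⟩
  have hA : ∀ ja, ((A ja).card : ℝ) ≤
      (3 / q) ^ n * (Fintype.card (Fin σ.card × Fin q) : ℝ) ^ m := by
    rintro ⟨j, a⟩
    by_cases hj : Function.Injective j
    · have h := card_prescribed_le j hj (fun i => σ.meeting q (a i) l) (3 * σ.card)
        (fun i => by exact_mod_cast σ.card_meeting_le hq hl) (A (j, a))
        (fun f hf => (Finset.mem_filter.1 hf).2.2)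
      have e : (3 * σ.card : ℝ) / Fintype.card (Fin σ.card × Fin q) = 3 / q := by
        rw [Fintype.card_prod, Fintype.card_fin, Fintype.card_fin]; push_cast; field_simp
      rwa [e] at h
    · have : A (j, a) = ∅ := Finset.filter_false_of_mem fun f _ h => hj h.1
      rw [this, Finset.card_empty, Nat.cast_zero]; positivity
  calc (F.card : ℝ) ≤ (((Finset.univ ×ˢ T).biUnion A).card : ℝ) := by
        exact_mod_cast Finset.card_le_card hsub
    _ ≤ ∑ ja ∈ Finset.univ ×ˢ T, ((A ja).card : ℝ) := by exact_mod_cast Finset.card_biUnion_le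
    _ ≤ ∑ _ja ∈ (Finset.univ : Finset (Fin n → Fin m)) ×ˢ T,
          (3 / q) ^ n * (Fintype.card (Fin σ.card × Fin q) : ℝ) ^ m :=
        Finset.sum_le_sum fun ja _ => hA ja
    _ = _ := by
        rw [Finset.sum_const, Finset.card_product, Finset.card_univ, Fintype.card_fun,
          Fintype.card_fin, Fintype.card_fin, nsmul_eq_mul]
        push_cast; ring

end CellFamily

/-! ### Refining a family of cells -/

/-- For large `x`, the mesh `1 / x` and the sample size `⌈x ^ b⌉` make both exceptional
probabilities less than one half. -/
lemma eventually_parameters {t b s' η δ A : ℝ} {n : ℕ} (ht1 : t ≤ 1) (htb : t < b)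
    (hsb : n * b + s' < n) (hη : 0 < η) (hδ : 0 < δ) :
    ∀ᶠ x : ℝ in atTop, 1 ≤ x ∧ 1 / x < δ ∧ 26 ≤ η * x ^ (-(t / 2)) * x ∧
      4 * x ^ 2 * Real.exp (1 - η * x ^ (-(t / 2)) * √(x ^ b) / 8) < 1 / 2 ∧
      (2 * x ^ b) ^ n * x ^ s' * (A / x) ^ n < 1 / 2 := by
  have e1 : ∀ᶠ x : ℝ in atTop, 1 ≤ x := eventually_ge_atTop 1
  have e2 : ∀ᶠ x : ℝ in atTop, 1 / δ < x := eventually_gt_atTop _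
  have e3 : ∀ᶠ x : ℝ in atTop, 26 / η ≤ x ^ (1 - t / 2) :=
    (tendsto_rpow_atTop (by linarith)).eventually_ge_atTop _
  have e4 : ∀ᶠ x : ℝ in atTop, 4 * x ^ 2 * Real.exp (1 - η * x ^ ((b - t) / 2) / 8) < 1 / 2 := by
    -- In terms of `y = x ^ ((b - t) / 2)` the left side is a power of `y` times `exp (1 - η y / 8)`.
    set c : ℝ := (b - t) / 2 with hc
    have hc0 : 0 < c := by rw [hc]; linarith
    have h1 := tendsto_rpow_mul_exp_neg_mul_atTop_nhds_zero (2 / c) (η / 8) (by positivity)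
    have h2 := (h1.comp (tendsto_rpow_atTop hc0)).const_mul (4 * Real.exp 1)
    rw [mul_zero] at h2
    filter_upwards [h2.eventually_lt_const (show (0 : ℝ) < 1 / 2 by norm_num), e1] with x hx hx1
    refine lt_of_eq_of_lt ?_ hx
    have hx0 : 0 ≤ x := by linarith
    simp only [Function.comp]
    rw [← Real.rpow_mul hx0, mul_div_cancel₀ _ hc0.ne', Real.rpow_two, sub_eq_add_neg,
      Real.exp_add, show -(η * x ^ c / 8) = -(η / 8) * x ^ c by ring]
    ring
  have e5 : ∀ᶠ x : ℝ in atTop, (2 * A) ^ n * x ^ (-(n - (n * b + s'))) < 1 / 2 := by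
    have h := (tendsto_rpow_neg_atTop (show 0 < (n : ℝ) - (n * b + s') by linarith)).const_mul
      ((2 * A) ^ n)
    rw [mul_zero] at h
    exact h.eventually_lt_const (by norm_num)
  filter_upwards [e1, e2, e3, e4, e5] with x h1 h2 h3 h4 h5
  have hx0 : 0 < x := by linarith
  refine ⟨h1, ?_, ?_, ?_, ?_⟩
  · rw [div_lt_iff₀ hx0]; rw [div_lt_iff₀ hδ] at h2; linarith
  · rw [div_le_iff₀ hη] at h3
    rw [mul_assoc, ← Real.rpow_add_one hx0.ne', neg_add_eq_sub, mul_comm]; exact h3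
  · rwa [mul_assoc η, Real.sqrt_eq_rpow, ← Real.rpow_mul hx0.le, ← Real.rpow_add hx0,
      show -(t / 2) + b * (1 / 2) = (b - t) / 2 by ring]
  · refine lt_of_eq_of_lt ?_ h5
    rw [mul_pow, mul_pow, div_pow, ← Real.rpow_mul_natCast hx0.le, ← Real.rpow_natCast x n,
      show -((n : ℝ) - (n * b + s')) = b * n + s' - n by ring, Real.rpow_sub hx0,
      Real.rpow_add hx0]
    ring

/-- The inductive step: a family of cells can be refined so that its measure changes by at most
`η |ξ| ^ (-t / 2)` on the Fourier side, while the `δ`-separated points of `E` are avoided. -/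
lemma CellFamily.exists_refinement (σ : CellFamily) {n : ℕ} (hn : 1 ≤ n) {E : Set (Fin n → ℝ)}
    (hE : Bornology.IsBounded E) {s : ℝ} (hs : 0 ≤ s) (hdim : lowerMinkowskiDim E ≤ (s : EReal))
    {t η δ : ℝ} (ht0 : 0 ≤ t) (ht : t < (n - s) / n) (hη : 0 < η) (hδ : 0 < δ) :
    ∃ σ' : CellFamily, σ'.support ⊆ σ.support ∧
      (∀ ξ, |ξ| ^ (t / 2) * ‖measureFourier σ'.toMeasure ξ - measureFourier σ.toMeasure ξ‖ ≤ η) ∧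
      ∀ x ∈ E, (∀ i i', i ≠ i' → δ ≤ |x i - x i'|) → ∃ i, x i ∉ σ'.support := by
  classical
  have hn0 : (0 : ℝ) < n := by exact_mod_cast hn
  have hQ : (0 : ℝ) < σ.res := by exact_mod_cast σ.res_pos
  have hβ1 : (n - s) / n ≤ 1 := by rw [div_le_one hn0]; linarith
  -- The sample size is about `H ^ b`, with `b` halfway between `t` and `(n - s) / n`.
  set b : ℝ := (t + (n - s) / n) / 2 with hb
  have htb : t < b := by rw [hb]; linarith
  have hbβ : n * b < n - s := by
    have : b < (n - s) / n := by rw [hb]; linarith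
    rw [lt_div_iff₀ hn0] at this; linarith
  -- The exponent `s' > s` bounds the covering numbers; the second half of the slack in
  -- `n * b < n - s` makes the expected number of bad tuples tend to zero.
  set s' : ℝ := (s + (n - n * b)) / 2 with hs'
  have hss' : s < s' := by rw [hs']; linarith
  have hs'b : n * b + s' < n := by rw [hs']; linarith
  -- The constant is such that `(A / H) ^ n = 2 ^ s' * (3 / q) ^ n` for `H = res * q`; the factor
  -- `2 ^ s'` pays for replacing `1 / l` by `2 * H`.
  set A : ℝ := 3 * σ.res * (2 ^ s') ^ (1 / (n : ℝ)) with hA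
  have hpar := eventually_parameters (A := A) (n := n) (by linarith) htb hs'b hη hδ
  -- For a covering by cubes of side `l`, the mesh `1 / (res * q)` is taken just above `l`.
  set q : ℝ → ℕ := fun l => ⌊1 / (σ.res * l)⌋₊ with hq
  have hlim : Tendsto (fun l : ℝ => ((σ.res * q l : ℕ) : ℝ)) (𝓝[>] 0) atTop := by
    have h1 : Tendsto (fun l : ℝ => 1 / (σ.res * l)) (𝓝[>] 0) atTop := by
      have := (tendsto_inv_nhdsGT_zero (𝕜 := ℝ)).const_mul_atTop (inv_pos.2 hQ)
      refine this.congr fun l => ?_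
      rw [one_div, mul_inv]
    have h2 := tendsto_natCast_atTop_atTop (R := ℝ) |>.comp (tendsto_nat_floor_atTop.comp h1)
    refine (h2.const_mul_atTop hQ).congr fun l => ?_
    simp [hq]
  have hsmall : ∀ᶠ l : ℝ in 𝓝[>] 0, 0 < l ∧ l < 1 / (2 * σ.res) :=
    Ioo_mem_nhdsGT (by positivity)
  obtain ⟨l, hcov, ⟨hl0, hl1⟩, hH1, hHδ, h26, hexp, hbad⟩ :=
    ((frequently_covering_le hss' hdim).and_eventually
      (hsmall.and (hlim.eventually hpar))).exists
  set H : ℕ := σ.res * q l with hH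
  have hHpos : 0 < H := by exact_mod_cast zero_lt_one.trans_le hH1
  have hqpos : 0 < q l := pos_of_mul_pos_right hHpos (Nat.zero_le _)
  have hHR : (0 : ℝ) < H := by exact_mod_cast hHpos
  have hqR : (0 : ℝ) < q l := by exact_mod_cast hqpos
  have hHeq : (H : ℝ) = σ.res * q l := by rw [hH]; push_cast; rfl
  have hlH : l * (H : ℝ) ≤ 1 := by
    have : (q l : ℝ) ≤ 1 / (σ.res * l) := Nat.floor_le (by positivity)
    rw [le_div_iff₀ (by positivity)] at this
    rw [hHeq]; linarith
  have hlH2 : 1 / l ≤ 2 * H := by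
    have h1 : 1 / (σ.res * l) < q l + 1 := Nat.lt_floor_add_one _
    rw [div_lt_iff₀ (by positivity)] at h1
    rw [lt_div_iff₀ (by positivity)] at hl1
    rw [div_le_iff₀ hl0, hHeq]
    nlinarith
  obtain ⟨T, hTcard, hT⟩ := exists_cover_card_eq hE hl0
  set m : ℕ := ⌈(H : ℝ) ^ b⌉₊ with hm
  have hb0 : 0 ≤ b := ht0.trans htb.le
  have hHb : 1 ≤ (H : ℝ) ^ b := Real.one_le_rpow hH1 hb0
  have hmlow : (H : ℝ) ^ b ≤ m := Nat.le_ceil _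
  have hmup : (m : ℝ) ≤ 2 * (H : ℝ) ^ b := by
    have := Nat.ceil_lt_add_one (zero_le_one.trans hHb)
    linarith
  have hmpos : 0 < m := by
    have : (0 : ℝ) < m := by linarith
    exact_mod_cast this
  set Λ : ℝ := η * (H : ℝ) ^ (-(t / 2)) with hΛ
  have hΛ0 : 0 < Λ := by positivity
  have : NeZero σ.card := ⟨σ.card_pos.ne'⟩
  have : NeZero (q l) := ⟨hqpos.ne'⟩
  set N : ℝ := (Fintype.card (Fin σ.card × Fin (q l)) : ℝ) ^ m with hN
  have hN0 : 0 < N := by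
    have : (0 : ℝ) < Fintype.card (Fin σ.card × Fin (q l)) := by exact_mod_cast Fintype.card_pos
    positivity
  let B₁ : Finset (Fin m → Fin σ.card × Fin (q l)) :=
    Finset.univ.filter fun f => ∃ ξ, Λ < ‖discrepancy (σ.subcell (q l)) H m f ξ‖
  let B₂ : Finset (Fin m → Fin σ.card × Fin (q l)) :=
    Finset.univ.filter fun f => ∃ j : Fin n → Fin m, Function.Injective j ∧ ∃ a ∈ T,
      ∀ i, f (j i) ∈ σ.meeting (q l) (a i) l
  have hB₁ : (B₁.card : ℝ) < 1 / 2 * N := by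
    have h := card_large_discrepancy_le hHpos (fun ω => (σ.subcell_lt (q := q l) ω).le) hmpos h26
      B₁ (fun f hf => (Finset.mem_filter.1 hf).2)
    refine h.trans_lt (mul_lt_mul_of_pos_right (lt_of_le_of_lt ?_ hexp) hN0)
    gcongr
  have hB₂ : (B₂.card : ℝ) < 1 / 2 * N := by
    have h := σ.card_meeting_samples_le (m := m) hqpos hlH T
    refine h.trans_lt (mul_lt_mul_of_pos_right (lt_of_le_of_lt ?_ hbad) hN0)
    have hAn : (A / H) ^ n = 2 ^ s' * (3 / q l) ^ n := by
      have h1 : A / H = (2 ^ s') ^ (1 / (n : ℝ)) * (3 / q l) := by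
        rw [hA, hHeq]; field_simp
      rw [h1, mul_pow, ← Real.rpow_natCast ((2 ^ s') ^ (1 / (n : ℝ))),
        ← Real.rpow_mul (by positivity), one_div_mul_cancel hn0.ne', Real.rpow_one]
    have hTc : (T.card : ℝ) ≤ 2 ^ s' * (H : ℝ) ^ s' := by
      rw [hTcard, ← Real.mul_rpow (by norm_num) hHR.le]
      exact hcov.trans (Real.rpow_le_rpow (by positivity) hlH2 (by linarith))
    calc (m : ℝ) ^ n * T.card * (3 / q l) ^ n
        ≤ (2 * (H : ℝ) ^ b) ^ n * (2 ^ s' * (H : ℝ) ^ s') * (3 / q l) ^ n := by gcongr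
      _ = _ := by rw [hAn]; ring
  obtain ⟨f, hf⟩ : ∃ f, f ∉ B₁ ∪ B₂ := by
    by_contra! hcon
    have h1 : (Finset.univ : Finset (Fin m → Fin σ.card × Fin (q l))) ⊆ B₁ ∪ B₂ :=
      fun f _ => hcon f
    have h2 := (Finset.card_le_card h1).trans (Finset.card_union_le _ _)
    rw [Finset.card_univ, Fintype.card_fun, Fintype.card_fin] at h2
    have h3 : N ≤ (B₁.card : ℝ) + B₂.card := by rw [hN]; exact_mod_cast h2
    linarith
  rw [Finset.mem_union, not_or] at hf
  obtain ⟨hf₁, hf₂⟩ := hf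
  simp only [B₁, B₂, Finset.mem_filter, Finset.mem_univ, true_and, not_exists, not_lt, not_and,
    not_forall] at hf₁ hf₂
  refine ⟨σ.sample hmpos f, σ.support_sample_subset hmpos f, fun ξ => ?_, ?_⟩
  · rw [σ.measureFourier_sample_sub hqpos, norm_mul]
    have hk := rpow_mul_norm_unitKernel_le (a := t / 2) (by linarith) (by linarith) (ξ / H)
    rw [abs_div, abs_of_pos hHR, Real.div_rpow (abs_nonneg _) hHR.le, div_mul_eq_mul_div,
      div_le_iff₀ (by positivity), one_mul] at hk
    calc |ξ| ^ (t / 2) * (‖discrepancy (σ.subcell (q l)) H m f ξ‖ * ‖unitKernel (ξ / H)‖)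
        = ‖discrepancy (σ.subcell (q l)) H m f ξ‖ * (|ξ| ^ (t / 2) * ‖unitKernel (ξ / H)‖) := by
          ring
      _ ≤ Λ * (H : ℝ) ^ (t / 2) := by
          gcongr; exact hf₁ ξ
      _ = η := by rw [hΛ, mul_assoc, ← Real.rpow_add hHR]; simp
  · exact σ.avoids_of_forall_not_meeting hqpos hmpos f hT hHδ fun j hj a ha => hf₂ j hj a ha

/-! ### The limit set -/

theorem mainTheorem7 (n : ℕ) (hn : 1 ≤ n) (s : ℝ) (hs : 0 ≤ s)
    (C : Set (Fin n → ℝ)) (hC : C ⊆ configSpace n Set.univ)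
    (Z : ℕ → Set (Fin n → ℝ)) (hCZ : C = ⋃ i, Z i)
    (hbdd : ∀ i, Bornology.IsBounded (Z i))
    (hdim : ∀ i, lowerMinkowskiDim (Z i) ≤ (s : EReal)) :
    ∃ X : Set ℝ, X ⊆ Set.Icc 0 1 ∧ AvoidsConfig X C ∧ ((n : ℝ) - s) / n ≤ fourierDim X := by
  have hn0 : (0 : ℝ) < n := by exact_mod_cast hn
  rcases le_or_gt (n : ℝ) s with hns | hns
  · refine ⟨∅, Set.empty_subset _, Set.disjoint_left.2 fun x hx => (hx.1 ⟨0, hn⟩).elim, ?_⟩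
    exact (div_nonpos_of_nonpos_of_nonneg (by linarith) hn0.le).trans (fourierDim_nonneg _)
  set β : ℝ := (n - s) / n with hβ
  have hβ0 : 0 < β := div_pos (by linarith) hn0
  have hβ1 : β ≤ 1 := by rw [hβ, div_le_one hn0]; linarith
  -- The exponents `τ k < β` of the successive refinements tend to `β`. The `k`-th refinement
  -- avoids the tuples of `Z i` with gaps at least `1 / (p + 1)`, where `k` codes the pair `(i, p)`.
  set τ : ℕ → ℝ := fun k => β * (1 - 1 / (k + 2)) with hτ
  have hτ0 : ∀ k, 0 ≤ τ k := fun k => by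
    have : 1 / ((k : ℝ) + 2) ≤ 1 := by
      rw [div_le_one (by positivity)]
      linarith [k.cast_nonneg (α := ℝ)]
    exact mul_nonneg hβ0.le (by linarith)
  have hτβ : ∀ k, τ k < β := fun k => by
    have : 0 < 1 / ((k : ℝ) + 2) := by positivity
    simp only [hτ]; nlinarith
  have hτmono : Monotone τ := fun j k hjk => by
    simp only [hτ]; gcongr
  have hτlim : Tendsto τ atTop (𝓝 β) := by
    have h : Tendsto (fun k : ℕ => 1 / ((k : ℝ) + 2)) atTop (𝓝 0) := by
      simpa [one_div, Function.comp_def] using tendsto_inv_atTop_zero.comp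
        (tendsto_atTop_add_const_right atTop (2 : ℝ) tendsto_natCast_atTop_atTop)
    simpa [hτ] using (h.const_sub 1).const_mul β
  choose next hsub hft havoid using fun (k : ℕ) (σ : CellFamily) =>
    σ.exists_refinement hn (hbdd k.unpair.1) hs (hdim k.unpair.1) (hτ0 k) (hτβ k)
      (show (0 : ℝ) < (1 / 2) ^ k by positivity)
      (show (0 : ℝ) < 1 / ((k.unpair.2 : ℝ) + 1) by positivity)
  let σ : ℕ → CellFamily := fun k =>
    Nat.rec (motive := fun _ => CellFamily) ⟨1, 1, fun _ => 0, one_pos, fun _ => one_pos⟩ next k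
  have hσ : ∀ k, σ (k + 1) = next k (σ k) := fun k => rfl
  have hanti : Antitone fun k => (σ k).support := antitone_nat_of_succ_le fun k => by
    rw [hσ]; exact hsub k (σ k)
  obtain ⟨ν, U, hU, hνX, hνlim⟩ := exists_limit_measure
    (fun k => ⟨(σ k).toMeasure, inferInstance⟩) (fun k => (σ k).support)
    (fun k => (σ k).isClosed_support) hanti (σ 0).support_subset
    (fun k => (σ k).measure_compl_support)
  refine ⟨⋂ k, (σ k).support, (Set.iInter_subset _ 0).trans (σ 0).support_subset, ?_, ?_⟩
  · refine Set.disjoint_left.2 fun x hx hxC => ?_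
    have hinj := (hC hxC).2
    rw [hCZ] at hxC
    obtain ⟨i, hi⟩ := Set.mem_iUnion.1 hxC
    obtain ⟨p, hp⟩ : ∃ p : ℕ, ∀ i i', i ≠ i' → 1 / ((p : ℝ) + 1) ≤ |x i - x i'| := by
      have h1 : ∀ᶠ p : ℕ in atTop, ∀ i i', i ≠ i' → 1 / ((p : ℝ) + 1) ≤ |x i - x i'| := by
        simp only [eventually_all]
        intro i i' hne
        exact (tendsto_one_div_add_atTop_nhds_zero_nat (𝕜 := ℝ)).eventually_le_const
          (abs_pos.2 (sub_ne_zero.2 (hinj.ne hne)))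
      exact h1.exists
    have h := havoid (Nat.pair i p) (σ (Nat.pair i p)) x
    rw [Nat.unpair_pair] at h
    obtain ⟨i', hi'⟩ := h hi hp
    rw [← hσ] at hi'
    exact hi' (Set.mem_iInter.1 (hx.1 i') (Nat.pair i p + 1))
  · refine (le_fourierDimMeasure (μ := (ν : Measure ℝ)) hβ1 fun t ht0 htβ => ?_).trans
      (fourierDimMeasure_le_fourierDim (IsProbabilityMeasure.ne_zero _)
        ⟨_, isClosed_iInter fun k => (σ k).isClosed_support, subset_rfl, hνX⟩)
    obtain ⟨k₀, hk₀⟩ := (hτlim.eventually_const_lt htβ).exists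
    refine ⟨(σ k₀).res ^ (t / 2) + 2, fun ξ => ?_⟩
    have hone : ∀ (μ : Measure ℝ) [IsProbabilityMeasure μ], ‖measureFourier μ ξ‖ ≤ 1 := by
      intro μ _
      rw [measureFourier_eq_integral_phase]
      simpa using norm_integral_le_of_norm_le_const (μ := μ) (f := fun x => phase (ξ * x)) (C := 1)
        (Eventually.of_forall fun x => (norm_phase _).le)
    rcases le_total |ξ| 1 with hξ | hξ
    · have h1 : |ξ| ^ (t / 2) ≤ 1 := Real.rpow_le_one (abs_nonneg _) hξ (by linarith)
      have h2 := mul_le_one₀ h1 (norm_nonneg _) (hone ν)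
      have h3 : (0 : ℝ) ≤ ((σ k₀).res : ℝ) ^ (t / 2) := by positivity
      linarith
    have hstep : ∀ k, k₀ ≤ k → |ξ| ^ (t / 2) * ‖measureFourier (σ (k + 1)).toMeasure ξ -
        measureFourier (σ k).toMeasure ξ‖ ≤ (1 / 2) ^ k := by
      intro k hk
      refine le_trans ?_ (hft k (σ k) ξ)
      rw [← hσ]
      have := hτmono hk
      gcongr
      linarith
    have hbound : ∀ k, |ξ| ^ (t / 2) * ‖measureFourier (σ (k₀ + k)).toMeasure ξ‖ ≤
        (σ k₀).res ^ (t / 2) + ∑ i ∈ Finset.range k, (1 / 2 : ℝ) ^ i := by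
      intro k
      induction k with
      | zero =>
        simpa using (σ k₀).rpow_mul_norm_measureFourier_le (a := t / 2) (by linarith)
          (by linarith) ξ
      | succ k ih =>
        rw [Finset.sum_range_succ, ← add_assoc, ← add_assoc]
        have h1 := hstep (k₀ + k) (Nat.le_add_right _ _)
        have h2 : (1 / 2 : ℝ) ^ (k₀ + k) ≤ (1 / 2) ^ k :=
          pow_le_pow_of_le_one (by norm_num) (by norm_num) (Nat.le_add_left _ _)
        have h3 : ‖measureFourier (σ (k₀ + k + 1)).toMeasure ξ‖ ≤
            ‖measureFourier (σ (k₀ + k + 1)).toMeasure ξ - measureFourier (σ (k₀ + k)).toMeasure ξ‖ +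
              ‖measureFourier (σ (k₀ + k)).toMeasure ξ‖ := by
          simpa using norm_add_le (measureFourier (σ (k₀ + k + 1)).toMeasure ξ -
            measureFourier (σ (k₀ + k)).toMeasure ξ) (measureFourier (σ (k₀ + k)).toMeasure ξ)
        have h4 := mul_le_mul_of_nonneg_left h3 (show 0 ≤ |ξ| ^ (t / 2) by positivity)
        rw [mul_add] at h4
        linarith
    have hlim := ((hνlim ξ).norm).const_mul (|ξ| ^ (t / 2))
    refine le_of_tendsto hlim (hU ?_)
    filter_upwards [eventually_ge_atTop k₀] with k hk
    obtain ⟨j, rfl⟩ := Nat.exists_eq_add_of_le hk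
    have hgeom : ∑ i ∈ Finset.range j, (1 / 2 : ℝ) ^ i ≤ 2 := sum_geometric_two_le j
    have := hbound j
    exact this.trans (by linarith)
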